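/- Let $A\in\mathbb{C}^{n\times n}$, $u,v\in\mathbb{C}^n$, let $m_A$ be the minimal polynomial of $A$, of degree $l$, let $B(\tau)=A+\tau uv^*$, and let $p_{uv}$ be the polynomial $p_{uv}(\lambda)=v^*m_A(\lambda)(\lambda I_n-A)^{-1}u$. For $t>0$ put $$\sigma(A,u,v;t)=\bigcup_{0\le\theta\le2\pi}\sigma\bigl(B(te^{i\theta})\bigr)\setminus\sigma(A).$$ Assume that $v^*u=\dots=v^*A^{\kappa-1}u=0$ and $v^*A^\kappa u\neq0$ for some $\kappa\in\{0,\dots,l-1\}$, and that no root of $p_{uv}$ is a root of $m_A$. Let $\zeta_1,\dots,\zeta_\nu$ ($\nu\ge 0$) be the distinct roots of $p_{uv}$, with multiplicities $k_1,\dots,k_\nu$. Let $c_{-1}$ be any complex number with $c_{-1}^{\kappa+1}=v^*A^\kappa u$ and put $$c_0=\frac1{\kappa+1}\cdot\frac{v^*A^{\kappa+1}u}{v^*A^\kappa u},\qquad c_1=\frac1{\kappa+1}\cdot\frac1{c_{-1}\,v^*A^\kappa u}\left(v^*A^{\kappa+2}u-\frac{\kappa+2}{2(\kappa+1)}\cdot\frac{(v^*A^{\kappa+1}u)^2}{v^*A^\kappa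 u}\right).$$ With $a_m(\zeta)=v^*(\zeta I_n-A)^{-m}u$, one has $a_{k_j+1}(\zeta_j)\ne0$ for every $j$. Let $b_1(\zeta_j)$ be any complex number with $b_1(\zeta_j)^{k_j}=a_{k_j+1}(\zeta_j)^{-1}$ and put $$b_2(\zeta_j)=-\frac1{k_j}\cdot\frac{b_1(\zeta_j)^2a_{k_j+2}(\zeta_j)}{a_{k_j+1}(\zeta_j)}.$$ Then for all sufficiently large $t$ the set $\sigma(A,u,v;t)$ is the union of $\nu+1$ pairwise disjoint simple closed curves $\Gamma_1,\dots,\Gamma_{\nu+1}$ (depending on $t$), parametrized by $\theta\in[0,2\pi]$, such that the following holds. For every $\tau$ with $|\tau|=t$, exactly $\kappa+1$ eigenvalues of $B(\tau)$, counted with algebraic multiplicity, lie on $\Gamma_{\nu+1}$; these are the eigenvalues which go to infinity. They trace out the curve: $\Gamma_{\nu+1}(\theta)$ is an eigenvalue of $B(te^{i(\kappa+1)\theta})$ for every $\theta$, and $$\Gamma_{\nu+1}(\theta)=c_{-1}t^{\frac1{\kappa+1}}e^{i\theta}+c_0+c_1t^{-\frac1{\kappa+1}}e^{-i\theta}+O\bigl(t^{-\frac2{\kappa+1}}\bigr).$$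 For every $j\in\{1,\dots,\nu\}$ and every $\tau$ with $|\tau|=t$, exactly $k_j$ eigenvalues of $B(\tau)$, counted with algebraic multiplicity, lie on $\Gamma_j$; these are the eigenvalues near $\zeta_j$. They trace out the curve: $\Gamma_j(\theta)$ is an eigenvalue of $B(te^{-ik_j\theta})$ for every $\theta$, and $$\Gamma_j(\theta)=\zeta_j-b_1(\zeta_j)t^{-\frac1{k_j}}e^{i\theta}-b_2(\zeta_j)t^{-\frac2{k_j}}e^{2i\theta}+O\bigl(t^{-\frac3{k_j}}\bigr).$$ In both cases the $O$ is as $t\to\infty$ and uniform in $\theta\in[0,2\pi]$. -/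

import Mathlib

open Polynomial

noncomputable section

/-- The scalar `v^* M u`, for a square matrix `M` and vectors `u`, `v`. -/
def starForm {n : ℕ} (M : Matrix (Fin n) (Fin n) ℂ) (u v : Fin n → ℂ) : ℂ :=
  star v ⬝ᵥ (M.mulVec u)

/-- The rank one perturbation `B(τ) = A + τ u v^*`. -/
def rankOnePert {n : ℕ} (A : Matrix (Fin n) (Fin n) ℂ) (u v : Fin n → ℂ) (τ : ℂ) :
    Matrix (Fin n) (Fin n) ℂ :=
  A + τ • Matrix.vecMulVec u (star v)

/-- `σ(A,u,v;t) = ⋃_{0 ≤ θ ≤ 2π} σ(A + t e^{iθ} u v^*) \ σ(A)`. -/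
def sigmaSet {n : ℕ} (A : Matrix (Fin n) (Fin n) ℂ) (u v : Fin n → ℂ) (t : ℝ) : Set ℂ :=
  (⋃ θ ∈ Set.Icc (0 : ℝ) (2 * Real.pi),
    spectrum ℂ (rankOnePert A u v ((t : ℂ) * Complex.exp ((θ : ℂ) * Complex.I)))) \ spectrum ℂ A

/-- The number of eigenvalues of `M` in the set `S`, counted with algebraic multiplicity. -/
def eigCount {n : ℕ} (M : Matrix (Fin n) (Fin n) ℂ) (S : Set ℂ) : ℕ :=
  haveI : DecidablePred (· ∈ S) := Classical.decPred _
  Multiset.card (M.charpoly.roots.filter (· ∈ S))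

/-- `a_m(z) = v^* (z I - A)^{-m} u`. -/
def aCoeff {n : ℕ} (A : Matrix (Fin n) (Fin n) ℂ) (u v : Fin n → ℂ) (m : ℕ) (z : ℂ) : ℂ :=
  starForm ((z • (1 : Matrix (Fin n) (Fin n) ℂ) - A)⁻¹ ^ m) u v

/-- The polynomial `p_{uv}(z) = v^* m_A(z) (z I - A)^{-1} u`, where `m_A` is the minimal polynomial
of `A`. It is written out with the identity
`m_A(z) I = m_A(z) I - m_A(A) = (z I - A) ∑ᵢ mᵢ ∑_{j < i} z^j A^{i-1-j}`;
`pUV_eval` proves the defining formula, which determines the polynomial. -/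
def pUV {n : ℕ} (A : Matrix (Fin n) (Fin n) ℂ) (u v : Fin n → ℂ) : ℂ[X] :=
  ∑ i ∈ Finset.range ((minpoly ℂ A).natDegree + 1), ∑ j ∈ Finset.range i,
    C ((minpoly ℂ A).coeff i * starForm (A ^ (i - 1 - j)) u v) * X ^ j

theorem starForm_add {n : ℕ} (M N : Matrix (Fin n) (Fin n) ℂ) (u v : Fin n → ℂ) :
    starForm (M + N) u v = starForm M u v + starForm N u v := by
  simp [starForm, Matrix.add_mulVec, dotProduct_add]

theorem starForm_smul {n : ℕ} (c : ℂ) (M : Matrix (Fin n) (Fin n) ℂ) (u v : Fin n → ℂ) :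
    starForm (c • M) u v = c * starForm M u v := by
  simp [starForm, Matrix.smul_mulVec]

theorem starForm_sum {n : ℕ} {ι : Type} (s : Finset ι) (f : ι → Matrix (Fin n) (Fin n) ℂ)
    (u v : Fin n → ℂ) :
    starForm (∑ i ∈ s, f i) u v = ∑ i ∈ s, starForm (f i) u v := by
  classical
  induction s using Finset.induction_on with
  | empty => simp [starForm]
  | insert a s ha ih => rw [Finset.sum_insert ha, Finset.sum_insert ha, starForm_add, ih]

/-- Off the spectrum of `A`, `p_{uv}(z) = m_A(z) v^* (z I - A)^{-1} u`. -/
theorem pUV_eval {n : ℕ} (A : Matrix (Fin n) (Fin n) ℂ) (u v : Fin n → ℂ) (z : ℂ)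
    (hz : z ∉ spectrum ℂ A) :
    (pUV A u v).eval z = (minpoly ℂ A).eval z *
      starForm ((z • (1 : Matrix (Fin n) (Fin n) ℂ) - A)⁻¹) u v := by
  set R : Matrix (Fin n) (Fin n) ℂ := z • 1 - A with hR
  set q : Matrix (Fin n) (Fin n) ℂ :=
    ∑ i ∈ Finset.range ((minpoly ℂ A).natDegree + 1), (minpoly ℂ A).coeff i •
      ∑ j ∈ Finset.range i, (z • (1 : Matrix (Fin n) (Fin n) ℂ)) ^ j * A ^ (i - 1 - j) with hq
  have h1 : (pUV A u v).eval z = starForm q u v := by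
    rw [hq, starForm_sum, pUV, eval_finsetSum]
    refine Finset.sum_congr rfl fun i _ => ?_
    rw [starForm_smul, starForm_sum, eval_finsetSum, Finset.mul_sum]
    refine Finset.sum_congr rfl fun j _ => ?_
    rw [_root_.smul_pow, one_pow, smul_mul_assoc, one_mul, starForm_smul]
    simp only [eval_mul, eval_C, eval_pow, eval_X]
    ring
  have hcomm : Commute (z • (1 : Matrix (Fin n) (Fin n) ℂ)) A :=
    (Commute.one_left A).smul_left z
  have h2 : R * q = (minpoly ℂ A).eval z • (1 : Matrix (Fin n) (Fin n) ℂ) := by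
    have hA := minpoly.aeval ℂ A
    rw [aeval_eq_sum_range] at hA
    rw [hq, Finset.mul_sum, eval_eq_sum_range, Finset.sum_smul]
    have : ∀ i ∈ Finset.range ((minpoly ℂ A).natDegree + 1),
        R * ((minpoly ℂ A).coeff i • ∑ j ∈ Finset.range i,
          (z • (1 : Matrix (Fin n) (Fin n) ℂ)) ^ j * A ^ (i - 1 - j)) =
        ((minpoly ℂ A).coeff i * z ^ i) • (1 : Matrix (Fin n) (Fin n) ℂ) -
          (minpoly ℂ A).coeff i • A ^ i := by
      intro i _
      rw [mul_smul_comm, hR, hcomm.mul_geom_sum₂, _root_.smul_pow, one_pow, smul_sub, smul_smul]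
    rw [Finset.sum_congr rfl this, Finset.sum_sub_distrib, hA, sub_zero]
  have hunit : IsUnit R := by
    have := spectrum.notMem_iff.mp hz
    rwa [Algebra.algebraMap_eq_smul_one] at this
  have h3 : q = (minpoly ℂ A).eval z • R⁻¹ := by
    have hd : IsUnit R.det := (Matrix.isUnit_iff_isUnit_det R).mp hunit
    calc q = R⁻¹ * (R * q) := by rw [Matrix.nonsing_inv_mul_cancel_left _ _ hd]
      _ = _ := by rw [h2, mul_smul_comm, mul_one]
  rw [h1, h3, starForm_smul]

end

/-!
Off `σ(A)`, a number `z` is an eigenvalue of `B(τ) = A + τ u v^*` exactly when `τ Q(z) = 1`, where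
`Q(z) = v^* (z - A)⁻¹ u = p_{uv}(z) / m_A(z)`; this is the matrix determinant lemma
(`charpoly_rankOnePert_eval`), and it also matches the multiplicities of `z` as an eigenvalue and as
a root of `m_A - τ p_{uv}` (`eigCount_rankOnePert`). So for `|τ| = t` large one looks for the points
where `Q` is small: near the zeros `ζ_j` of `p_{uv}`, and near infinity.

At each of these points `Q` is, in a local coordinate `w`, of the form `w ^ N g(w)` with `g` analytic
and `g 0 ≠ 0`. The Taylor coefficients of `g` are read off from the Neumann series of the resolvent
(`exists_starForm_inv_one_sub`): they are `v^* A ^ (κ + i) u` at infinity (`w = 1 / z`, `N = κ + 1`)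
and `a_{k + 1 + i}(ζ)` at a root (`w = ζ - z`, `N = k`). An `N`-th root of `w ^ N g(w)` is a local
coordinate too; its inverse is `y ↦ y X(y)` (`exists_local_root`), and differentiating the equation
`Y ^ N = g(y / Y)` for `Y = 1 / X` gives its expansion (`deriv_of_pow_eq`). This yields one branch `Z`
at each point, with `Q(Z(y)) = y ^ N`, and the curves are the images of the circles
`|y| = t ^ (-1 / N)`.

That nothing else occurs is a count of degrees. For every `τ` with `|τ|` large the branches supply
`(κ + 1) + ∑ k_j = (κ + 1) + deg p_{uv} = deg m_A` distinct roots of `m_A - τ p_{uv}`, a polynomial of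
degree `deg m_A` (`natDegree_pUV`, `spheres_of_branches`). Hence these are all its roots, and all of
them are simple; no compactness argument is needed to exclude further eigenvalues.
-/

/-! ### Expansion of the resolvent -/

section

-- Any normed algebra structure on matrices will do: it only serves to make sense of analyticity.
attribute [local instance] Matrix.linftyOpNormedRing Matrix.linftyOpNormedAlgebra

theorem starForm_mulVec {n : ℕ} (M N : Matrix (Fin n) (Fin n) ℂ) (u v : Fin n → ℂ) :
    starForm M (N.mulVec u) v = starForm (M * N) u v := by
  simp [starForm, Matrix.mulVec_mulVec]

theorem analyticAt_starForm_inv {n : ℕ} (C M : Matrix (Fin n) (Fin n) ℂ) (u v : Fin n → ℂ) :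
    AnalyticAt ℂ (fun w : ℂ => starForm (C * (1 - w • M)⁻¹) u v) 0 := by
  let φ : Matrix (Fin n) (Fin n) ℂ →ₗ[ℂ] ℂ :=
    { toFun := fun N => starForm (C * N) u v
      map_add' := fun X Y => by rw [mul_add, starForm_add]
      map_smul' := fun c X => by rw [mul_smul_comm, starForm_smul]; rfl }
  have h1 : AnalyticAt ℂ (fun w : ℂ => (1 : Matrix (Fin n) (Fin n) ℂ) - w • M) 0 := by
    fun_prop
  have h2 : AnalyticAt ℂ (fun w : ℂ => Ring.inverse ((1 : Matrix (Fin n) (Fin n) ℂ) - w • M)) 0 := by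
    refine AnalyticAt.fun_comp_of_eq (g := Ring.inverse) ?_ h1 rfl
    rw [zero_smul, sub_zero]
    exact analyticAt_inverse (𝕜 := ℂ) (1 : (Matrix (Fin n) (Fin n) ℂ)ˣ)
  have h3 : AnalyticAt ℂ (fun w : ℂ => LinearMap.toContinuousLinearMap φ
      (Ring.inverse ((1 : Matrix (Fin n) (Fin n) ℂ) - w • M))) 0 :=
    AnalyticAt.fun_comp_of_eq ((LinearMap.toContinuousLinearMap φ).analyticAt _) h2 rfl
  refine h3.congr (Filter.Eventually.of_forall fun w => ?_)
  simp only [Matrix.nonsing_inv_eq_ringInverse]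
  rfl

theorem eventually_isUnit_one_sub_smul {n : ℕ} (M : Matrix (Fin n) (Fin n) ℂ) :
    ∀ᶠ w : ℂ in nhds 0, IsUnit (1 - w • M) := by
  have h1 : Filter.Tendsto (fun w : ℂ => (1 : Matrix (Fin n) (Fin n) ℂ) - w • M) (nhds 0)
      (nhds 1) := by
    have : Continuous (fun w : ℂ => (1 : Matrix (Fin n) (Fin n) ℂ) - w • M) := by fun_prop
    simpa using this.tendsto 0
  exact h1.eventually ((Units.isOpen (R := Matrix (Fin n) (Fin n) ℂ)).mem_nhds isUnit_one)

end

/-- The Neumann series of `(1 - w M)⁻¹` with its exact remainder. -/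
theorem inv_one_sub_smul_eq {n : ℕ} (M : Matrix (Fin n) (Fin n) ℂ) {w : ℂ}
    (hw : IsUnit (1 - w • M)) (j : ℕ) :
    (1 - w • M)⁻¹ = ∑ i ∈ Finset.range j, w ^ i • M ^ i + w ^ j • (M ^ j * (1 - w • M)⁻¹) := by
  have hd : IsUnit (1 - w • M).det := (Matrix.isUnit_iff_isUnit_det _).mp hw
  have h1 := geom_sum_mul_neg (w • M) j
  have h2 : (∑ i ∈ Finset.range j, (w • M) ^ i) = (1 - (w • M) ^ j) * (1 - w • M)⁻¹ := by
    rw [← h1, Matrix.mul_nonsing_inv_cancel_right _ _ hd]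
  simp only [_root_.smul_pow] at h2
  rw [h2, sub_mul, one_mul, smul_mul_assoc, sub_add_cancel]

theorem starForm_inv_one_sub_eq {n : ℕ} (M : Matrix (Fin n) (Fin n) ℂ) (u v : Fin n → ℂ) {w : ℂ}
    (hw : IsUnit (1 - w • M)) {k : ℕ} (h0 : ∀ i < k, starForm (M ^ i) u v = 0) :
    starForm (1 - w • M)⁻¹ u v = w ^ k * (starForm (M ^ k) u v + starForm (M ^ (k + 1)) u v * w +
      starForm (M ^ (k + 2)) u v * w ^ 2 +
      w ^ 3 * starForm (M ^ (k + 3) * (1 - w • M)⁻¹) u v) := by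
  conv_lhs => rw [inv_one_sub_smul_eq M hw (k + 3)]
  rw [starForm_add, starForm_sum, starForm_smul, Finset.sum_range_succ, Finset.sum_range_succ,
    Finset.sum_range_succ, Finset.sum_eq_zero]
  · simp only [starForm_smul]; ring
  · intro i hi
    rw [starForm_smul, h0 i (Finset.mem_range.mp hi), mul_zero]

/-- Near `0`, `v^* (1 - w M)⁻¹ u` is `w ^ k` times an analytic function whose Taylor coefficients
are `v^* M ^ (k + i) u`, when the coefficients below `k` vanish. -/
theorem exists_starForm_inv_one_sub {n : ℕ} (M : Matrix (Fin n) (Fin n) ℂ) (u v : Fin n → ℂ)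
    {k : ℕ} (h0 : ∀ i < k, starForm (M ^ i) u v = 0) :
    ∃ r : ℂ → ℂ, AnalyticAt ℂ r 0 ∧ ∀ᶠ w in nhds 0,
      starForm (1 - w • M)⁻¹ u v = w ^ k * (starForm (M ^ k) u v +
        starForm (M ^ (k + 1)) u v * w + starForm (M ^ (k + 2)) u v * w ^ 2 + w ^ 3 * r w) :=
  ⟨_, analyticAt_starForm_inv (M ^ (k + 3)) M u v,
    (eventually_isUnit_one_sub_smul M).mono fun _ hw => starForm_inv_one_sub_eq M u v hw h0⟩

/-- If `v^* (1 - w M)⁻¹ u = w ^ k h(w)` with `h` continuous and nonzero at `0`, then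
`v^* M ^ k u` is the first nonzero moment. -/
theorem starForm_pow_of_eventually_eq {n : ℕ} (M : Matrix (Fin n) (Fin n) ℂ) (u v : Fin n → ℂ)
    {k : ℕ} {h : ℂ → ℂ} (hc : ContinuousAt h 0)
    (hh : ∀ᶠ w in nhdsWithin (0 : ℂ) {0}ᶜ, starForm (1 - w • M)⁻¹ u v = w ^ k * h w) :
    (∀ i < k, starForm (M ^ i) u v = 0) ∧ starForm (M ^ k) u v = h 0 := by
  -- divide by `w ^ j` and let `w → 0`: only for `j = k` does the right-hand side survive
  have key : ∀ j ≤ k, (∀ i < j, starForm (M ^ i) u v = 0) →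
      starForm (M ^ j) u v = 0 ^ (k - j) * h 0 := by
    intro j hj hlt
    obtain ⟨r, hr, hev⟩ := exists_starForm_inv_one_sub M u v hlt
    have hrc := hr.continuousAt
    have hcont : ContinuousAt (fun w : ℂ => starForm (M ^ j) u v +
        starForm (M ^ (j + 1)) u v * w + starForm (M ^ (j + 2)) u v * w ^ 2 + w ^ 3 * r w) 0 := by
      fun_prop
    have hcont' : ContinuousAt (fun w : ℂ => w ^ (k - j) * h w) 0 := by fun_prop
    have e := tendsto_nhds_unique_of_eventuallyEq
      (hcont.tendsto.mono_left (nhdsWithin_le_nhds (s := {0}ᶜ)))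
      (hcont'.tendsto.mono_left nhdsWithin_le_nhds) (by
        filter_upwards [hh, nhdsWithin_le_nhds hev, self_mem_nhdsWithin] with w h1 h2 h3
        have hw : w ^ j ≠ 0 := pow_ne_zero _ h3
        apply mul_left_cancel₀ hw
        rw [← h2, h1, ← mul_assoc, ← pow_add, Nat.add_sub_cancel' hj])
    simpa using e
  have hz : ∀ i < k, starForm (M ^ i) u v = 0 := by
    intro i
    induction i using Nat.strong_induction_on with
    | _ i ih =>
      intro hi
      rw [key i hi.le fun i' h' => ih i' h' (h'.trans hi), zero_pow (by omega), zero_mul]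
  exact ⟨hz, by simpa using key k le_rfl hz⟩

/-! ### Local roots of analytic functions -/

/-- The equation `w ^ N * g w = y ^ N` is solved near `0` by `w = y * X y` with `X` analytic and
`X 0 = b`, where `b` is a prescribed `N`-th root of `(g 0)⁻¹`. -/
theorem exists_local_root {g : ℂ → ℂ} {b : ℂ} {N : ℕ} (hN : N ≠ 0)
    (hg : AnalyticAt ℂ g 0) (hb : b ^ N * g 0 = 1) :
    ∃ X : ℂ → ℂ, AnalyticAt ℂ X 0 ∧ X 0 = b ∧
      (∀ᶠ y in nhds 0, X y ^ N * g (y * X y) = 1) ∧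
      ∃ s ∈ nhds (0 : ℂ), Set.InjOn (fun y => y * X y) s := by
  have hb0 : b ≠ 0 := by
    rintro rfl
    simp [hN] at hb
  have hg0 : g 0 ≠ 0 := by
    intro h
    simp [h] at hb
  -- `c ^ N = g / g 0` with `c 0 = 1`, so that `h ^ N = w ^ N * g w` for `h w = w * c w / b`;
  -- `F` is the local inverse of `h`, and `X` is written so that `F y = y * X y`
  set c : ℂ → ℂ := fun w => (g w / g 0) ^ ((N : ℂ)⁻¹) with hc
  have hca : AnalyticAt ℂ c 0 := by
    refine AnalyticAt.cpow (by fun_prop (disch := assumption)) analyticAt_const ?_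
    rw [div_self hg0]
    exact Complex.one_mem_slitPlane
  have hc0 : c 0 = 1 := by simp [hc, div_self hg0]
  have hcN : ∀ w, c w ^ N = g w / g 0 := fun w => Complex.cpow_nat_inv_pow _ hN
  set h : ℂ → ℂ := fun w => w * (b⁻¹ * c w) with hh
  have hha : AnalyticAt ℂ h 0 := by fun_prop
  have hh0 : h 0 = 0 := by simp [hh]
  have hd : deriv h 0 ≠ 0 := by
    have h1 : HasDerivAt (fun w => b⁻¹ * c w) _ (0 : ℂ) :=
      (hca.differentiableAt.hasDerivAt).const_mul b⁻¹
    have h2 : HasDerivAt h _ (0 : ℂ) := (hasDerivAt_id (0 : ℂ)).mul h1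
    rw [h2.deriv]
    simp [hc0, hb0]
  set F := hha.hasStrictDerivAt.localInverse _ _ _ hd with hF
  have hFa : AnalyticAt ℂ F 0 := by
    have := hha.analyticAt_localInverse hd
    rwa [hh0] at this
  have hF0 : F 0 = 0 := by
    have := HasStrictFDerivAt.localInverse_apply_image
      (hha.hasStrictDerivAt.hasStrictFDerivAt_equiv hd)
    rwa [hh0] at this
  have hright : ∀ᶠ y in nhds 0, h (F y) = y := by
    have := HasStrictDerivAt.eventually_right_inverse hha.hasStrictDerivAt hd
    rwa [hh0] at this
  have hcF : AnalyticAt ℂ (fun y => c (F y)) 0 := hca.fun_comp_of_eq hFa hF0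
  have hcF0 : ∀ᶠ y in nhds 0, c (F y) ≠ 0 :=
    hcF.continuousAt.eventually_ne (by rw [hF0, hc0]; exact one_ne_zero)
  have hyX : ∀ᶠ y in nhds 0, y * (b * (c (F y))⁻¹) = F y := by
    filter_upwards [hright, hcF0] with y h1 h2
    have h3 : F y * (b⁻¹ * c (F y)) = y := h1
    calc y * (b * (c (F y))⁻¹) = F y * (b⁻¹ * c (F y)) * (b * (c (F y))⁻¹) := by rw [h3]
      _ = F y := by field_simp
  refine ⟨fun y => b * (c (F y))⁻¹, analyticAt_const.mul (hcF.inv (by rw [hF0, hc0]; simp)),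
    by simp [hF0, hc0], ?_, {y | y * (b * (c (F y))⁻¹) = F y ∧ h (F y) = y}, hyX.and hright, ?_⟩
  · filter_upwards [hyX, hcF0] with y h1 h2
    have h3 : g (F y) ≠ 0 := by
      intro h4
      have := hcN (F y)
      rw [h4, zero_div] at this
      exact h2 (by simpa [hN] using this)
    rw [h1, mul_pow, inv_pow, hcN]
    field_simp
    exact hb
  · intro y hy y' hy' he
    simp only at he
    rw [hy.1, hy'.1] at he
    rw [← hy.2, ← hy'.2, he]

theorem isBigO_taylor_two {f : ℂ → ℂ} (hf : AnalyticAt ℂ f 0) :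
    (fun y => f y - (f 0 + deriv f 0 * y + deriv (deriv f) 0 / 2 * y ^ 2)) =O[nhds 0]
      fun y => y ^ 3 := by
  have h := hf.hasFPowerSeriesAt.isBigO_sub_partialSum_pow 3
  refine (h.congr' (Filter.Eventually.of_forall fun y => ?_) (Filter.EventuallyEq.refl _ _)).trans
    (Asymptotics.isBigO_of_le _ fun y => by simp)
  simp [FormalMultilinearSeries.partialSum, Finset.sum_range_succ, iteratedDeriv_succ]
  ring

theorem isBigO_taylor_one {f : ℂ → ℂ} (hf : AnalyticAt ℂ f 0) :
    (fun y => f y - (f 0 + deriv f 0 * y)) =O[nhds 0] fun y => y ^ 2 := by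
  have h := hf.hasFPowerSeriesAt.isBigO_sub_partialSum_pow 2
  refine (h.congr' (Filter.Eventually.of_forall fun y => ?_) (Filter.EventuallyEq.refl _ _)).trans
    (Asymptotics.isBigO_of_le _ fun y => by simp)
  simp [FormalMultilinearSeries.partialSum, Finset.sum_range_succ, iteratedDeriv_succ]
  ring

/-- Taylor coefficients of an analytic solution `Y` of `Y ^ N = g (y / Y)`, found by differentiating
the equation twice. -/
theorem deriv_of_pow_eq {Y g r : ℂ → ℂ} {m g0 g1 g2 : ℂ} {N : ℕ} (hN : N ≠ 0)
    (hY : AnalyticAt ℂ Y 0) (hY0 : Y 0 = m) (hm : m ≠ 0) (hr : AnalyticAt ℂ r 0)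
    (hg : ∀ w, g w = g0 + g1 * w + g2 * w ^ 2 + w ^ 3 * r w)
    (he : ∀ᶠ y in nhds 0, Y y ^ N = g (y / Y y)) :
    deriv Y 0 = 1 / N * (g1 / g0) ∧
    deriv (deriv Y) 0 / 2 = 1 / N * (1 / (g0 * m)) *
      (g2 - ((N : ℂ) + 1) / (2 * N) * (g1 ^ 2 / g0)) := by
  have hN' : (N : ℂ) ≠ 0 := Nat.cast_ne_zero.mpr hN
  have hmN : m ^ N = g0 := by
    have := he.self_of_nhds
    rwa [hg, hY0, zero_div, mul_zero, add_zero, zero_pow (by norm_num), zero_pow (by norm_num),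
      mul_zero, zero_mul, add_zero, add_zero] at this
  set D := deriv Y with hD
  have hDa : AnalyticAt ℂ D 0 := hY.deriv
  -- the derivative of `g`, written out so that its own derivative at `0` is visible
  set g' : ℂ → ℂ := fun w => g1 + 2 * g2 * w + (3 * w ^ 2 * r w + w ^ 3 * deriv r w) with hg'
  have hgd : ∀ᶠ w in nhds 0, HasDerivAt g (g' w) w := by
    filter_upwards [hr.eventually_analyticAt] with w hw
    have h1 := ((hasDerivAt_const w g0).add ((hasDerivAt_id w).const_mul g1)).add
      (((hasDerivAt_id w).pow 2).const_mul g2)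
    have h2 := h1.add (((hasDerivAt_id w).pow 3).mul hw.differentiableAt.hasDerivAt)
    refine (h2.congr_deriv ?_).congr_of_eventuallyEq (Filter.Eventually.of_forall fun x => ?_)
    · simp [hg']; ring
    · simp [hg]
  have hg'd : HasDerivAt g' (2 * g2) 0 := by
    have hr1 := hr.differentiableAt.hasDerivAt
    have hr2 := hr.deriv.differentiableAt.hasDerivAt
    have h1 := (((hasDerivAt_id (0 : ℂ)).const_mul (2 * g2)).const_add g1).add
      (((((hasDerivAt_id (0 : ℂ)).pow 2).const_mul 3).mul hr1).add
        (((hasDerivAt_id (0 : ℂ)).pow 3).mul hr2))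
    refine (h1.congr_deriv ?_).congr_of_eventuallyEq (Filter.Eventually.of_forall fun x => ?_)
    · simp
    · simp [hg']
  have hYne : ∀ᶠ y in nhds 0, Y y ≠ 0 := hY.continuousAt.eventually_ne (by rwa [hY0])
  have hq : ContinuousAt (fun y => y / Y y) 0 :=
    continuousAt_id.div hY.continuousAt (by rwa [hY0])
  have hqt : Filter.Tendsto (fun y => y / Y y) (nhds 0) (nhds 0) := by
    simpa using hq.tendsto
  have hqd : ∀ᶠ y in nhds 0, HasDerivAt (fun y => y / Y y) ((Y y - y * D y) / Y y ^ 2) y := by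
    filter_upwards [hY.eventually_analyticAt, hYne] with y h1 h2
    have h3 : HasDerivAt (fun y => y / Y y) _ y :=
      (hasDerivAt_id y).div h1.differentiableAt.hasDerivAt h2
    exact h3.congr_deriv (by simp [hD])
  have he1 : ∀ᶠ y in nhds 0, N * Y y ^ (N - 1) * D y =
      g' (y / Y y) * ((Y y - y * D y) / Y y ^ 2) := by
    filter_upwards [he.eventually_nhds, hqt.eventually hgd, hqd, hY.eventually_analyticAt]
      with y h1 h2 h3 h4
    have h5 : HasDerivAt (fun y => Y y ^ N) _ y := h4.differentiableAt.hasDerivAt.pow N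
    have h6 : HasDerivAt (fun y => g (y / Y y)) _ y := HasDerivAt.comp y h2 h3
    exact h5.unique (h6.congr_of_eventuallyEq h1)
  have hD0 : N * m ^ (N - 1) * D 0 = g1 / m := by
    have := he1.self_of_nhds
    simp only [hY0, zero_div, hg'] at this
    rw [this]
    field_simp
    ring
  have hd1 : HasDerivAt (fun y => N * Y y ^ (N - 1) * D y)
      (N * ((N - 1 : ℕ) * m ^ (N - 1 - 1) * D 0) * D 0 + N * m ^ (N - 1) * deriv D 0) 0 := by
    have := ((hY.differentiableAt.hasDerivAt.pow (N - 1)).const_mul (N : ℂ)).mul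
      hDa.differentiableAt.hasDerivAt
    refine this.congr_deriv ?_
    simp [hY0, hD]
  have hd2 : HasDerivAt (fun y => g' (y / Y y) * ((Y y - y * D y) / Y y ^ 2))
      (2 * g2 * (1 / m) * (1 / m) + g1 * (-2 * D 0 / m ^ 2)) 0 := by
    have h1 : HasDerivAt (fun y => g' (y / Y y)) (2 * g2 * (1 / m)) 0 := by
      have hq0 := hqd.self_of_nhds
      have h2 : HasDerivAt g' (2 * g2) ((0 : ℂ) / Y 0) := by rwa [zero_div]
      refine (HasDerivAt.comp (0 : ℂ) h2 hq0).congr_deriv ?_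
      rw [hY0]; field_simp; ring
    have h3 := ((hY.differentiableAt.hasDerivAt).sub
      ((hasDerivAt_id (0 : ℂ)).mul hDa.differentiableAt.hasDerivAt)).div
      (hY.differentiableAt.hasDerivAt.pow 2) (pow_ne_zero 2 (by rwa [hY0]))
    refine (h1.mul h3).congr_deriv ?_
    simp [hY0, hg', ← hD]
    field_simp
  have hE := hd1.unique (hd2.congr_of_eventuallyEq he1)
  obtain ⟨M, rfl⟩ : ∃ M, N = M + 1 := ⟨N - 1, by omega⟩
  have hD0' : D 0 = 1 / ((M + 1 : ℕ) : ℂ) * (g1 / g0) := by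
    rw [← hmN]
    simp only [Nat.add_sub_cancel] at hD0
    field_simp at hD0 ⊢
    rw [← hD0]; ring
  refine ⟨hD0', ?_⟩
  have hkey : (M + 1 : ℕ) * m ^ (M + 1 + 1) * deriv D 0 =
      2 * g2 - 2 * g1 * D 0 - (M + 1 : ℕ) * M * m ^ (M + 1) * D 0 ^ 2 := by
    -- for `N = 1` the exponent `N - 2` in the second derivative is truncated
    rcases M with _ | M
    · simp at hE ⊢
      rw [hE]; field_simp; ring
    · simp only [Nat.add_sub_cancel] at hE
      field_simp at hE
      push_cast at hE ⊢
      ring_nf at hE ⊢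
      linear_combination hE
  have hg0 : g0 ≠ 0 := hmN ▸ pow_ne_zero _ hm
  rw [pow_succ, hmN, hD0'] at hkey
  have : deriv D 0 = (2 * g2 - 2 * g1 * (1 / ((M + 1 : ℕ) : ℂ) * (g1 / g0)) -
      (M + 1 : ℕ) * M * g0 * (1 / ((M + 1 : ℕ) : ℂ) * (g1 / g0)) ^ 2) /
        ((M + 1 : ℕ) * (g0 * m)) := by
    rw [eq_div_iff (mul_ne_zero hN' (mul_ne_zero hg0 hm)), ← hkey]; ring
  rw [this]
  push_cast at hN' ⊢
  field_simp
  ring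

/-- `exists_local_root` with the expansions of `X` and `X⁻¹` in terms of the coefficients of `g`. -/
theorem exists_local_root_expansion {g r : ℂ → ℂ} {b g0 g1 g2 : ℂ} {N : ℕ} (hN : N ≠ 0)
    (hr : AnalyticAt ℂ r 0) (hg : ∀ w, g w = g0 + g1 * w + g2 * w ^ 2 + w ^ 3 * r w)
    (hb : b ^ N * g0 = 1) :
    ∃ X : ℂ → ℂ, AnalyticAt ℂ X 0 ∧ X 0 = b ∧
      (∀ᶠ y in nhds 0, X y ^ N * g (y * X y) = 1) ∧
      (∃ s ∈ nhds (0 : ℂ), Set.InjOn (fun y => y * X y) s) ∧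
      (fun y => X y - (b - 1 / N * (b ^ 2 * g1 / g0) * y)) =O[nhds 0] (fun y => y ^ 2) ∧
      (fun y => (X y)⁻¹ - (b⁻¹ + 1 / N * (g1 / g0) * y + 1 / N * (1 / (g0 * b⁻¹)) *
        (g2 - ((N : ℂ) + 1) / (2 * N) * (g1 ^ 2 / g0)) * y ^ 2)) =O[nhds 0] (fun y => y ^ 3) := by
  have hga : AnalyticAt ℂ g 0 := by
    rw [funext hg]
    fun_prop
  have hg00 : g 0 = g0 := by simp [hg]
  obtain ⟨X, hX, hX0, hXe, hXi⟩ := exists_local_root hN hga (by rwa [hg00])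
  have hb0 : b ≠ 0 := by
    rintro rfl
    simp [hN] at hb
  have hYa : AnalyticAt ℂ (fun y => (X y)⁻¹) 0 := hX.inv (by rwa [hX0])
  have hXne : ∀ᶠ y in nhds 0, X y ≠ 0 := hX.continuousAt.eventually_ne (by rwa [hX0])
  have hYe : ∀ᶠ y in nhds 0, (fun y => (X y)⁻¹) y ^ N = g (y / (fun y => (X y)⁻¹) y) := by
    filter_upwards [hXe, hXne] with y h1 h2
    simp only [div_inv_eq_mul, inv_pow]
    exact inv_eq_of_mul_eq_one_right h1
  obtain ⟨h1, h2⟩ := deriv_of_pow_eq hN hYa (m := b⁻¹) (by simp only [hX0]) (inv_ne_zero hb0)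
    hr hg hYe
  refine ⟨X, hX, hX0, hXe, hXi, ?_, ?_⟩
  · have h3 := hX.differentiableAt.hasDerivAt.inv (by rwa [hX0])
    have h4 : deriv X 0 = -(1 / N * (b ^ 2 * g1 / g0)) := by
      have h5 := h3.deriv
      rw [show (X⁻¹ : ℂ → ℂ) = fun y => (X y)⁻¹ from rfl, h1, hX0, eq_div_iff (pow_ne_zero 2 hb0)]
        at h5
      rw [← neg_eq_iff_eq_neg, ← h5]
      ring
    have h5 := isBigO_taylor_one hX
    rw [h4, hX0] at h5
    simpa [sub_eq_add_neg] using h5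
  · have h5 := isBigO_taylor_two hYa
    rw [h1, h2, hX0] at h5
    exact h5

/-! ### The secular polynomial -/

theorem mem_spectrum_iff_isRoot_minpoly {n : ℕ} (A : Matrix (Fin n) (Fin n) ℂ) (z : ℂ) :
    z ∈ spectrum ℂ A ↔ (minpoly ℂ A).IsRoot z := by
  rw [← Matrix.minpoly_toLin', ← Module.End.hasEigenvalue_iff_isRoot,
    Module.End.hasEigenvalue_iff_mem_spectrum, Matrix.spectrum_toLin']

theorem isUnit_smul_one_sub {n : ℕ} {A : Matrix (Fin n) (Fin n) ℂ} {z : ℂ}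
    (hz : z ∉ spectrum ℂ A) : IsUnit (z • (1 : Matrix (Fin n) (Fin n) ℂ) - A) := by
  have := spectrum.notMem_iff.mp hz
  rwa [Algebra.algebraMap_eq_smul_one] at this

/-- The polynomial `m_A - τ p_{uv}`. Its roots outside `σ(A)` are the eigenvalues of `B(τ)` there,
with the same multiplicities. -/
noncomputable def secularPoly {n : ℕ} (A : Matrix (Fin n) (Fin n) ℂ) (u v : Fin n → ℂ) (τ : ℂ) :
    ℂ[X] :=
  minpoly ℂ A - C τ * pUV A u v

theorem pUV_coeff {n : ℕ} (A : Matrix (Fin n) (Fin n) ℂ) (u v : Fin n → ℂ) (d : ℕ) :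
    (pUV A u v).coeff d = ∑ i ∈ Finset.range ((minpoly ℂ A).natDegree + 1),
      if d < i then (minpoly ℂ A).coeff i * starForm (A ^ (i - 1 - d)) u v else 0 := by
  rw [pUV, finsetSum_coeff]
  refine Finset.sum_congr rfl fun i _ => ?_
  simp only [finsetSum_coeff, coeff_C_mul, coeff_X_pow, mul_ite, mul_one, mul_zero,
    Finset.sum_ite_eq, Finset.mem_range]

theorem pUV_coeff_top {n : ℕ} (A : Matrix (Fin n) (Fin n) ℂ) (u v : Fin n → ℂ) {κ : ℕ}
    (hκ : κ < (minpoly ℂ A).natDegree) (hzero : ∀ i < κ, starForm (A ^ i) u v = 0) :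
    (pUV A u v).coeff ((minpoly ℂ A).natDegree - 1 - κ) = starForm (A ^ κ) u v := by
  have hmon : (minpoly ℂ A).Monic := minpoly.monic A.isIntegral
  rw [pUV_coeff, Finset.sum_eq_single (minpoly ℂ A).natDegree]
  · rw [if_pos (by omega), hmon.coeff_natDegree, one_mul]
    congr 2
    omega
  · intro i hi hil
    rw [Finset.mem_range] at hi
    split_ifs with h
    · rw [hzero _ (by omega), mul_zero]
    · rfl
  · intro h
    exact absurd (Finset.mem_range.mpr (Nat.lt_succ_self _)) h

theorem pUV_ne_zero {n : ℕ} (A : Matrix (Fin n) (Fin n) ℂ) (u v : Fin n → ℂ) {κ : ℕ}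
    (hκ : κ < (minpoly ℂ A).natDegree) (hzero : ∀ i < κ, starForm (A ^ i) u v = 0)
    (hne : starForm (A ^ κ) u v ≠ 0) : pUV A u v ≠ 0 := by
  intro h
  rw [← pUV_coeff_top A u v hκ hzero, h, coeff_zero] at hne
  exact hne rfl

theorem natDegree_pUV {n : ℕ} (A : Matrix (Fin n) (Fin n) ℂ) (u v : Fin n → ℂ) {κ : ℕ}
    (hκ : κ < (minpoly ℂ A).natDegree) (hzero : ∀ i < κ, starForm (A ^ i) u v = 0)
    (hne : starForm (A ^ κ) u v ≠ 0) :
    (pUV A u v).natDegree + (κ + 1) = (minpoly ℂ A).natDegree := by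
  have hle : (pUV A u v).natDegree ≤ (minpoly ℂ A).natDegree - 1 - κ := by
    rw [natDegree_le_iff_coeff_eq_zero]
    intro d hd
    rw [pUV_coeff]
    refine Finset.sum_eq_zero fun i hi => ?_
    split_ifs with h
    · rw [Finset.mem_range] at hi
      rw [hzero _ (by omega), mul_zero]
    · rfl
  have hge := le_natDegree_of_ne_zero (pUV_coeff_top A u v hκ hzero ▸ hne)
  omega

theorem sum_rootMultiplicity {ν : ℕ} {p : ℂ[X]} (hp : p ≠ 0) {ζ : Fin ν → ℂ}
    (hinj : Function.Injective ζ) (hζ : ∀ z, p.IsRoot z ↔ ∃ j, ζ j = z) :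
    ∑ j, p.rootMultiplicity (ζ j) = p.natDegree := by
  have h : p.roots.toFinset = Finset.univ.image ζ := by
    ext z
    rw [Multiset.mem_toFinset, mem_roots hp, hζ]
    simp
  rw [← splits_iff_card_roots.mp (IsAlgClosed.splits p), ← Multiset.toFinset_sum_count_eq, h,
    Finset.sum_image fun i _ j _ hij => hinj hij]
  simp only [count_roots]

theorem natDegree_pUV_lt {n : ℕ} (A : Matrix (Fin n) (Fin n) ℂ) (u v : Fin n → ℂ) {κ : ℕ}
    (hκ : κ < (minpoly ℂ A).natDegree) (hzero : ∀ i < κ, starForm (A ^ i) u v = 0)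
    (hne : starForm (A ^ κ) u v ≠ 0) :
    (pUV A u v).natDegree < (minpoly ℂ A).natDegree := by
  have := natDegree_pUV A u v hκ hzero hne
  omega

theorem secularPoly_natDegree {n : ℕ} (A : Matrix (Fin n) (Fin n) ℂ) (u v : Fin n → ℂ) (τ : ℂ)
    (h : (pUV A u v).natDegree < (minpoly ℂ A).natDegree) :
    (secularPoly A u v τ).natDegree = (minpoly ℂ A).natDegree :=
  natDegree_sub_eq_left_of_natDegree_lt ((natDegree_C_mul_le _ _).trans_lt h)

theorem secularPoly_eval {n : ℕ} (A : Matrix (Fin n) (Fin n) ℂ) (u v : Fin n → ℂ) (τ z : ℂ)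
    (hz : z ∉ spectrum ℂ A) :
    (secularPoly A u v τ).eval z =
      (minpoly ℂ A).eval z * (1 - τ * starForm ((z • 1 - A)⁻¹) u v) := by
  rw [secularPoly, eval_sub, eval_mul, eval_C, pUV_eval A u v z hz]
  ring

/-- The characteristic polynomial of `B(τ)`, by the matrix determinant lemma. -/
theorem charpoly_rankOnePert_eval {n : ℕ} (A : Matrix (Fin n) (Fin n) ℂ) (u v : Fin n → ℂ)
    (τ z : ℂ) (hz : z ∉ spectrum ℂ A) :
    (rankOnePert A u v τ).charpoly.eval z =
      A.charpoly.eval z * (1 - τ * starForm ((z • 1 - A)⁻¹) u v) := by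
  have hd := (Matrix.isUnit_iff_isUnit_det _).mp (isUnit_smul_one_sub hz)
  have h := Matrix.det_add_replicateCol_mul_replicateRow (ι := Unit) hd (-τ • u) (star v)
  have hs : Matrix.scalar (Fin n) z = z • (1 : Matrix (Fin n) (Fin n) ℂ) :=
    (Matrix.smul_one_eq_diagonal z).symm
  have h1 : z • 1 - rankOnePert A u v τ = z • 1 - A +
      Matrix.replicateCol Unit (-τ • u) * Matrix.replicateRow Unit (star v) := by
    rw [← Matrix.vecMulVec_eq, rankOnePert, Matrix.smul_vecMulVec, neg_smul]
    abel
  have h2 : (1 + Matrix.replicateRow Unit (star v) * (z • 1 - A)⁻¹ *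
      Matrix.replicateCol Unit (-τ • u)).det = 1 - τ * starForm ((z • 1 - A)⁻¹) u v := by
    rw [Matrix.det_unique, Matrix.mul_assoc, ← Matrix.replicateCol_mulVec, Matrix.add_apply,
      Matrix.replicateRow_mul_replicateCol_apply, Matrix.mulVec_smul, dotProduct_smul, starForm]
    simp [sub_eq_add_neg]
  rw [Matrix.eval_charpoly, Matrix.eval_charpoly, hs, h1, h, h2]

/-- The polynomial form of `charpoly_rankOnePert_eval`: two polynomials that agree off the finite
set `σ(A)` are equal. -/
theorem charpoly_rankOnePert_mul {n : ℕ} (A : Matrix (Fin n) (Fin n) ℂ) (u v : Fin n → ℂ) (τ : ℂ) :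
    (rankOnePert A u v τ).charpoly * minpoly ℂ A = A.charpoly * secularPoly A u v τ := by
  refine eq_of_infinite_eval_eq _ _ ((A.finite_spectrum.infinite_compl).mono fun z hz => ?_)
  simp only [Set.mem_ofPred_eq, eval_mul, charpoly_rankOnePert_eval A u v τ z hz,
    secularPoly_eval A u v τ z hz]
  ring

theorem mem_spectrum_rankOnePert_iff {n : ℕ} (A : Matrix (Fin n) (Fin n) ℂ) (u v : Fin n → ℂ)
    (τ z : ℂ) (hz : z ∉ spectrum ℂ A) :
    z ∈ spectrum ℂ (rankOnePert A u v τ) ↔ τ * starForm ((z • 1 - A)⁻¹) u v = 1 := by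
  have h0 : A.charpoly.eval z ≠ 0 := fun h => hz (Matrix.mem_spectrum_iff_isRoot_charpoly.mpr h)
  rw [Matrix.mem_spectrum_iff_isRoot_charpoly, IsRoot, charpoly_rankOnePert_eval A u v τ z hz,
    mul_eq_zero, or_iff_right h0, sub_eq_zero, eq_comm]

theorem isRoot_secularPoly_iff {n : ℕ} (A : Matrix (Fin n) (Fin n) ℂ) (u v : Fin n → ℂ)
    (τ z : ℂ) (hz : z ∉ spectrum ℂ A) :
    (secularPoly A u v τ).IsRoot z ↔ τ * starForm ((z • 1 - A)⁻¹) u v = 1 := by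
  have h0 : (minpoly ℂ A).eval z ≠ 0 := fun h => hz ((mem_spectrum_iff_isRoot_minpoly A z).mpr h)
  rw [IsRoot, secularPoly_eval A u v τ z hz, mul_eq_zero, or_iff_right h0, sub_eq_zero, eq_comm]

/-- Off `σ(A)`, eigenvalues of `B(τ)` may be counted as roots of `m_A - τ p_{uv}`. -/
theorem eigCount_rankOnePert {n : ℕ} (A : Matrix (Fin n) (Fin n) ℂ) (u v : Fin n → ℂ) (τ : ℂ)
    (hs : secularPoly A u v τ ≠ 0) {S : Set ℂ} [DecidablePred (· ∈ S)]
    (hS : ∀ z ∈ S, z ∉ spectrum ℂ A) :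
    eigCount (rankOnePert A u v τ) S =
      Multiset.card ((secularPoly A u v τ).roots.filter (· ∈ S)) := by
  have he : eigCount (rankOnePert A u v τ) S =
      Multiset.card ((rankOnePert A u v τ).charpoly.roots.filter (· ∈ S)) := by
    unfold eigCount
    congr!
  rw [he]
  congr 1
  ext z
  rw [Multiset.count_filter, Multiset.count_filter]
  split_ifs with hz
  · have hm : minpoly ℂ A ≠ 0 := minpoly.ne_zero A.isIntegral
    have h := congrArg (rootMultiplicity z) (charpoly_rankOnePert_mul A u v τ)
    rw [rootMultiplicity_mul (mul_ne_zero (Matrix.charpoly_monic _).ne_zero hm),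
      rootMultiplicity_mul (mul_ne_zero (Matrix.charpoly_monic _).ne_zero hs),
      rootMultiplicity_eq_zero (p := minpoly ℂ A)
        (fun h => hS z hz ((mem_spectrum_iff_isRoot_minpoly A z).mpr h)),
      rootMultiplicity_eq_zero (p := A.charpoly)
        (fun h => hS z hz (Matrix.mem_spectrum_iff_isRoot_charpoly.mpr h))] at h
    rw [count_roots, count_roots]
    omega
  · rfl

/-- If disjoint finite sets of roots have as many elements as the degree allows, they exhaust the
multiset of roots; in particular all roots are simple. -/
theorem roots_eq_biUnion {ι : Type*} [Fintype ι] {f : ℂ[X]} (hf : f ≠ 0) {E : ι → Finset ℂ}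
    (hE : ∀ i, ∀ z ∈ E i, f.IsRoot z) (hd : Pairwise fun i j => Disjoint (E i) (E j))
    (hc : ∑ i, (E i).card = f.natDegree) : f.roots = (Finset.univ.biUnion E).val := by
  symm
  refine Multiset.eq_of_le_of_card_le ?_ ?_
  · rw [Finset.val_le_iff_val_subset]
    intro z hz
    obtain ⟨i, -, hi⟩ := Finset.mem_biUnion.mp (Finset.mem_val.mp hz)
    exact (mem_roots hf).mpr (hE i z hi)
  · rw [Finset.card_val, Finset.card_biUnion fun i _ j _ hij => hd hij, hc]
    exact card_roots' f

theorem card_nthRoots_toFinset {N : ℕ} (hN : N ≠ 0) {a : ℂ} (ha : a ≠ 0) :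
    (nthRoots N a).toFinset.card = N := by
  have hp := Complex.isPrimitiveRoot_exp N hN
  rw [Multiset.toFinset_card_of_nodup (hp.nthRoots_nodup ha), hp.card_nthRoots,
    if_pos (IsAlgClosed.exists_pow_nat_eq a (Nat.pos_of_ne_zero hN))]

/-! ### Local branches of eigenvalues -/

/-- `Z` is a local inverse of an `N`-th root of `Q(z) = v^* (z - A)⁻¹ u`: for `y ≠ 0` near `0`,
`Q(Z(y)) = y ^ N`, and `Z` is continuous and injective with values off `σ(A)`. The filter `L` is the
limit of `Z` at `0`: `𝓝 ζ` for the eigenvalues near a zero `ζ` of `Q`, `cobounded ℂ` for those that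
go to infinity. Nothing is asked at `y = 0` itself. -/
structure IsBranch {n : ℕ} (A : Matrix (Fin n) (Fin n) ℂ) (u v : Fin n → ℂ) (N : ℕ)
    (Z : ℂ → ℂ) (L : Filter ℂ) : Prop where
  continuousAt : ∀ᶠ y in nhdsWithin (0 : ℂ) {0}ᶜ, ContinuousAt Z y
  notMem : ∀ᶠ y in nhdsWithin (0 : ℂ) {0}ᶜ, Z y ∉ spectrum ℂ A
  starForm_eq : ∀ᶠ y in nhdsWithin (0 : ℂ) {0}ᶜ, starForm ((Z y • 1 - A)⁻¹) u v = y ^ N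
  injOn : ∃ s ∈ nhdsWithin (0 : ℂ) {0}ᶜ, Set.InjOn Z s
  tendsto : Filter.Tendsto Z (nhdsWithin (0 : ℂ) {0}ᶜ) L

theorem aCoeff_succ {n : ℕ} (A : Matrix (Fin n) (Fin n) ℂ) (u v : Fin n → ℂ) (m : ℕ) (z : ℂ) :
    aCoeff A u v (m + 1) z =
      starForm ((z • 1 - A)⁻¹ ^ m) ((z • 1 - A)⁻¹.mulVec u) v := by
  rw [starForm_mulVec, ← pow_succ, aCoeff]

/-- Shifting `z` to `ζ - w` replaces `A` by the resolvent `R = (ζ - A)⁻¹` and `u` by `R u`. -/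
theorem starForm_inv_sub {n : ℕ} {A : Matrix (Fin n) (Fin n) ℂ} (u v : Fin n → ℂ) {ζ : ℂ}
    (hζ : ζ ∉ spectrum ℂ A) (w : ℂ) :
    starForm (((ζ - w) • 1 - A)⁻¹) u v =
      starForm ((1 - w • (ζ • 1 - A)⁻¹)⁻¹) ((ζ • 1 - A)⁻¹.mulVec u) v := by
  have hd := (Matrix.isUnit_iff_isUnit_det _).mp (isUnit_smul_one_sub hζ)
  have h : (ζ - w) • 1 - A = (ζ • 1 - A) * (1 - w • (ζ • 1 - A)⁻¹) := by
    rw [mul_sub, mul_one, mul_smul_comm, Matrix.mul_nonsing_inv _ hd, sub_smul]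
    abel
  rw [starForm_mulVec, h, Matrix.mul_inv_rev]

theorem eventually_notMem_spectrum {n : ℕ} {A : Matrix (Fin n) (Fin n) ℂ} {ζ : ℂ}
    (hζ : ζ ∉ spectrum ℂ A) : ∀ᶠ z in nhds ζ, z ∉ spectrum ℂ A :=
  A.finite_spectrum.isClosed.isOpen_compl.mem_nhds hζ

/-- At a zero of `p_{uv}` of multiplicity `k` off `σ(A)`, `a_1, …, a_k` vanish and `a_{k+1}` does
not: up to sign and factorials, they are the derivatives of `p_{uv} / m_A`. -/
theorem aCoeff_at_root {n : ℕ} {A : Matrix (Fin n) (Fin n) ℂ} {u v : Fin n → ℂ} {ζ : ℂ} {k : ℕ}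
    (hp : pUV A u v ≠ 0) (hk : k = (pUV A u v).rootMultiplicity ζ) (hζ : ζ ∉ spectrum ℂ A) :
    (∀ i < k, aCoeff A u v (i + 1) ζ = 0) ∧ aCoeff A u v (k + 1) ζ ≠ 0 := by
  obtain ⟨q, hq, hdvd⟩ := exists_eq_pow_rootMultiplicity_mul_and_not_dvd _ hp ζ
  rw [← hk] at hq
  have hq0 : q.eval ζ ≠ 0 := fun h => hdvd (dvd_iff_isRoot.mpr h)
  have hm0 : (minpoly ℂ A).eval ζ ≠ 0 := fun h => hζ ((mem_spectrum_iff_isRoot_minpoly A ζ).mpr h)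
  have hc : ContinuousAt (fun w : ℂ => (-1) ^ k * q.eval (ζ - w) / (minpoly ℂ A).eval (ζ - w)) 0 := by
    refine ContinuousAt.div ?_ ?_ (by simpa using hm0)
    · exact Continuous.continuousAt (by fun_prop)
    · exact Continuous.continuousAt (by fun_prop)
  have ht : Filter.Tendsto (fun w : ℂ => ζ - w) (nhds 0) (nhds ζ) := by
    have : Continuous fun w : ℂ => ζ - w := by fun_prop
    simpa using this.tendsto 0
  obtain ⟨h1, h2⟩ := starForm_pow_of_eventually_eq (ζ • 1 - A)⁻¹ ((ζ • 1 - A)⁻¹.mulVec u) v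
    (k := k) hc (by
      filter_upwards [nhdsWithin_le_nhds (ht.eventually (eventually_notMem_spectrum hζ))] with w hw
      have hm : (minpoly ℂ A).eval (ζ - w) ≠ 0 :=
        fun h => hw ((mem_spectrum_iff_isRoot_minpoly A _).mpr h)
      have h3 := pUV_eval A u v _ hw
      rw [hq] at h3
      simp only [eval_mul, eval_pow, eval_sub, eval_X, eval_C] at h3
      rw [← starForm_inv_sub u v hζ w, ← mul_right_inj' hm, ← h3, sub_sub_cancel_left, neg_pow]
      field_simp)
  refine ⟨fun i hi => by rw [aCoeff_succ]; exact h1 i hi, ?_⟩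
  rw [aCoeff_succ, h2]
  simpa using ⟨hq0, hm0⟩

theorem eventually_continuousAt {X : ℂ → ℂ} (hX : AnalyticAt ℂ X 0) :
    ∀ᶠ y in nhds 0, ContinuousAt X y :=
  hX.eventually_analyticAt.mono fun _ h => h.continuousAt

/-- The branch of eigenvalues near a root `ζ` of `p_{uv}`, `Z y = ζ - y * X y`. -/
theorem exists_branch_at_root {n : ℕ} {A : Matrix (Fin n) (Fin n) ℂ} {u v : Fin n → ℂ} {ζ : ℂ}
    {k : ℕ} (hp : pUV A u v ≠ 0) (hk : k = (pUV A u v).rootMultiplicity ζ) (hk0 : k ≠ 0)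
    (hζ : ζ ∉ spectrum ℂ A) {b₁ b₂ : ℂ} (hb₁ : b₁ ^ k = (aCoeff A u v (k + 1) ζ)⁻¹)
    (hb₂ : b₂ = -(1 / (k : ℂ)) * (b₁ ^ 2 * aCoeff A u v (k + 2) ζ / aCoeff A u v (k + 1) ζ)) :
    ∃ Z : ℂ → ℂ, IsBranch A u v k Z (nhds ζ) ∧
      (fun y => Z y - (ζ - b₁ * y - b₂ * y ^ 2)) =O[nhdsWithin 0 {0}ᶜ] fun y => y ^ 3 := by
  obtain ⟨hz, hne⟩ := aCoeff_at_root hp hk hζ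
  obtain ⟨r, hr, hev⟩ := exists_starForm_inv_one_sub (ζ • 1 - A)⁻¹ ((ζ • 1 - A)⁻¹.mulVec u) v
    (k := k) (fun i hi => by rw [← aCoeff_succ]; exact hz i hi)
  simp only [← aCoeff_succ] at hev
  obtain ⟨X, hX, hX0, hXe, ⟨s, hs, hsi⟩, hXO, -⟩ := exists_local_root_expansion
    (b := b₁) hk0 hr (fun w => rfl) (by rw [hb₁, inv_mul_cancel₀ hne])
  have hyc : ContinuousAt (fun y => y * X y) 0 := continuousAt_id.mul hX.continuousAt
  have hyt : Filter.Tendsto (fun y => y * X y) (nhds 0) (nhds 0) := by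
    simpa using hyc.tendsto
  have hZt : Filter.Tendsto (fun y => ζ - y * X y) (nhds 0) (nhds ζ) := by
    simpa using hyt.const_sub ζ
  refine ⟨fun y => ζ - y * X y, ⟨?_, ?_, ?_, ⟨s, nhdsWithin_le_nhds hs, ?_⟩,
    hZt.mono_left nhdsWithin_le_nhds⟩, ?_⟩
  · filter_upwards [nhdsWithin_le_nhds (eventually_continuousAt hX)] with y hy
    fun_prop
  · exact nhdsWithin_le_nhds (hZt.eventually (eventually_notMem_spectrum hζ))
  · filter_upwards [nhdsWithin_le_nhds (hyt.eventually hev), nhdsWithin_le_nhds hXe] with y h1 h2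
    rw [starForm_inv_sub u v hζ, h1, mul_pow, mul_assoc, h2, mul_one]
  · exact fun y hy y' hy' h => hsi hy hy' (sub_right_injective h)
  · refine Asymptotics.IsBigO.mono ?_ nhdsWithin_le_nhds
    have h := ((Asymptotics.isBigO_refl (fun y : ℂ => -y) (nhds 0)).mul hXO).trans
      (Asymptotics.isBigO_of_le (g := fun y : ℂ => y ^ 3) _ fun y => by
        rw [← norm_neg (y ^ 3)]
        exact le_of_eq (congrArg norm (by ring)))
    refine h.congr_left fun y => ?_
    rw [hb₂]
    ring

/-- The substitution `z = 1 / w`, which moves infinity to `0`. -/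
theorem starForm_inv_inv {n : ℕ} {A : Matrix (Fin n) (Fin n) ℂ} (u v : Fin n → ℂ) {w : ℂ}
    (hw0 : w ≠ 0) (hw : IsUnit (1 - w • A)) :
    w⁻¹ ∉ spectrum ℂ A ∧
      starForm ((w⁻¹ • 1 - A)⁻¹) u v = w * starForm ((1 - w • A)⁻¹) u v := by
  have hd := (Matrix.isUnit_iff_isUnit_det _).mp hw
  have h : (w⁻¹ • 1 - A) * (w • (1 - w • A)⁻¹) = 1 := by
    rw [mul_smul_comm, ← smul_mul_assoc, smul_sub, smul_smul, mul_inv_cancel₀ hw0, one_smul,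
      Matrix.mul_nonsing_inv _ hd]
  refine ⟨?_, ?_⟩
  · rw [spectrum.notMem_iff, Algebra.algebraMap_eq_smul_one]
    exact IsUnit.of_mul_eq_one _ h
  · rw [Matrix.inv_eq_right_inv h, starForm_smul]

/-- The branch of eigenvalues that go to infinity, `Z y = 1 / (y * X y)`. -/
theorem exists_branch_at_infinity {n : ℕ} {A : Matrix (Fin n) (Fin n) ℂ} {u v : Fin n → ℂ} {κ : ℕ}
    (hzero : ∀ i < κ, starForm (A ^ i) u v = 0) (hne : starForm (A ^ κ) u v ≠ 0)
    {cm c₀ c₁ : ℂ} (hcm : cm ^ (κ + 1) = starForm (A ^ κ) u v)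
    (hc₀ : c₀ = 1 / ((κ : ℂ) + 1) * (starForm (A ^ (κ + 1)) u v / starForm (A ^ κ) u v))
    (hc₁ : c₁ = 1 / ((κ : ℂ) + 1) * (1 / (starForm (A ^ κ) u v * cm)) *
      (starForm (A ^ (κ + 2)) u v - ((κ : ℂ) + 2) / (2 * ((κ : ℂ) + 1)) *
        (starForm (A ^ (κ + 1)) u v ^ 2 / starForm (A ^ κ) u v))) :
    ∃ Z : ℂ → ℂ, IsBranch A u v (κ + 1) Z (Bornology.cobounded ℂ) ∧
      (fun y => Z y - (cm * y⁻¹ + c₀ + c₁ * y)) =O[nhdsWithin 0 {0}ᶜ] fun y => y ^ 2 := by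
  obtain ⟨r, hr, hev⟩ := exists_starForm_inv_one_sub A u v hzero
  have hcm0 : cm ≠ 0 := by
    rintro rfl
    exact hne (by rw [← hcm, zero_pow (Nat.succ_ne_zero κ)])
  obtain ⟨X, hX, hX0, hXe, ⟨s, hs, hsi⟩, -, hXO⟩ := exists_local_root_expansion
    (b := cm⁻¹) (Nat.succ_ne_zero κ) hr (fun w => rfl)
    (by rw [inv_pow, hcm, inv_mul_cancel₀ hne])
  have hyc : ContinuousAt (fun y => y * X y) 0 := continuousAt_id.mul hX.continuousAt
  have hyt : Filter.Tendsto (fun y => y * X y) (nhds 0) (nhds 0) := by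
    simpa using hyc.tendsto
  have hXne : ∀ᶠ y in nhds 0, X y ≠ 0 :=
    hX.continuousAt.eventually_ne (by rw [hX0]; exact inv_ne_zero hcm0)
  have hne0 : ∀ᶠ y in nhdsWithin (0 : ℂ) {0}ᶜ, y * X y ≠ 0 := by
    filter_upwards [nhdsWithin_le_nhds hXne, self_mem_nhdsWithin] with y h1 h2
    exact mul_ne_zero h2 h1
  have hyt' : Filter.Tendsto (fun y => y * X y) (nhdsWithin 0 {0}ᶜ) (nhdsWithin 0 {0}ᶜ) :=
    tendsto_nhdsWithin_iff.mpr ⟨hyt.mono_left nhdsWithin_le_nhds, hne0⟩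
  have hun := nhdsWithin_le_nhds (s := {0}ᶜ) (hyt.eventually (eventually_isUnit_one_sub_smul A))
  refine ⟨fun y => (y * X y)⁻¹, ⟨?_, ?_, ?_, ⟨s, nhdsWithin_le_nhds hs, ?_⟩,
    Filter.tendsto_inv₀_nhdsNE_zero.comp hyt'⟩, ?_⟩
  · filter_upwards [nhdsWithin_le_nhds (eventually_continuousAt hX), hne0] with y hy h0
    exact ContinuousAt.inv₀ (by fun_prop) h0
  · filter_upwards [hne0, hun] with y h1 h2
    exact (starForm_inv_inv u v h1 h2).1
  · filter_upwards [hne0, hun, nhdsWithin_le_nhds (hyt.eventually hev), nhdsWithin_le_nhds hXe]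
      with y h1 h2 h3 h4
    rw [(starForm_inv_inv u v h1 h2).2, h3, ← mul_assoc, ← pow_succ', mul_pow, mul_assoc, h4,
      mul_one]
  · exact fun y hy y' hy' h => hsi hy hy' (inv_injective h)
  · have h := (Asymptotics.isBigO_refl (fun y : ℂ => y⁻¹) (nhdsWithin 0 {0}ᶜ)).mul
      (hXO.mono nhdsWithin_le_nhds)
    refine h.congr' ?_ ?_
    · filter_upwards [self_mem_nhdsWithin] with y hy
      have hy : y ≠ 0 := hy
      rw [hc₀, hc₁, inv_inv, mul_inv, mul_sub]
      congr 1
      push_cast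
      rw [show (κ : ℂ) + 1 + 1 = κ + 2 by ring]
      field_simp
    · filter_upwards [self_mem_nhdsWithin] with y hy
      have hy : y ≠ 0 := hy
      field_simp

/-! ### Counting eigenvalues on the curves -/

/-- Let `Q(z) = v^* (z - A)⁻¹ u`. Suppose maps `Z i`, injective and with disjoint images on the
circles of radius `ρ i = t ^ (-1 / N i)`, satisfy `Q (Z i y) = y ^ N i` there, and that the `N i` add
up to `deg m_A`. Then for each `|τ| = t` the `N i`-th roots of `1 / τ` give `N i` roots of
`m_A - τ p_{uv}` on the `i`-th image, and these exhaust the degree. So the images make up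
`σ(A,u,v;t)`, and all the eigenvalues on them are simple. -/
theorem spheres_of_branches {n : ℕ} (A : Matrix (Fin n) (Fin n) ℂ) (u v : Fin n → ℂ)
    {ι : Type*} [Fintype ι] {N : ι → ℕ} (hN : ∀ i, N i ≠ 0)
    (hdeg : (pUV A u v).natDegree < (minpoly ℂ A).natDegree)
    (hsum : ∑ i, N i = (minpoly ℂ A).natDegree)
    {t : ℝ} (ht : 0 < t) {ρ : ι → ℝ} (hρ : ∀ i, 0 < ρ i) (hρN : ∀ i, ρ i ^ N i = t⁻¹)
    {Z : ι → ℂ → ℂ} (hinj : ∀ i, Set.InjOn (Z i) (Metric.sphere 0 (ρ i)))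
    (hZA : ∀ i, ∀ y ∈ Metric.sphere 0 (ρ i), Z i y ∉ spectrum ℂ A)
    (hZQ : ∀ i, ∀ y ∈ Metric.sphere 0 (ρ i), starForm ((Z i y • 1 - A)⁻¹) u v = y ^ N i)
    (hdisj : Pairwise fun i j =>
      Disjoint (Z i '' Metric.sphere 0 (ρ i)) (Z j '' Metric.sphere 0 (ρ j))) :
    (⋃ i, Z i '' Metric.sphere 0 (ρ i)) = sigmaSet A u v t ∧
    (∀ τ : ℂ, ‖τ‖ = t → ∀ i,
      eigCount (rankOnePert A u v τ) (Z i '' Metric.sphere 0 (ρ i)) = N i) ∧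
    (∀ i, ∀ y ∈ Metric.sphere 0 (ρ i), ∀ τ, τ * y ^ N i = 1 →
      Z i y ∈ spectrum ℂ (rankOnePert A u v τ)) := by
  classical
  have hspec : ∀ i, ∀ y ∈ Metric.sphere 0 (ρ i), ∀ τ, τ * y ^ N i = 1 →
      Z i y ∈ spectrum ℂ (rankOnePert A u v τ) := fun i y hy τ h => by
    rwa [mem_spectrum_rankOnePert_iff A u v τ _ (hZA i y hy), hZQ i y hy]
  have hall : ∀ τ : ℂ, ‖τ‖ = t → ∃ E : ι → Finset ℂ, (∀ i, (E i).card = N i) ∧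
      (∀ i, ∀ z ∈ E i, z ∈ Z i '' Metric.sphere 0 (ρ i)) ∧
      (secularPoly A u v τ).roots = (Finset.univ.biUnion E).val := by
    intro τ hτ
    have hτ0 : τ ≠ 0 := norm_ne_zero_iff.mp (hτ ▸ ht.ne')
    have hmem : ∀ i, ∀ y ∈ (nthRoots (N i) τ⁻¹).toFinset,
        y ∈ Metric.sphere (0 : ℂ) (ρ i) ∧ τ * y ^ N i = 1 := by
      intro i y hy
      rw [Multiset.mem_toFinset, mem_nthRoots (Nat.pos_of_ne_zero (hN i))] at hy
      refine ⟨?_, by rw [hy, mul_inv_cancel₀ hτ0]⟩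
      rw [mem_sphere_zero_iff_norm]
      refine (pow_left_inj₀ (norm_nonneg y) (hρ i).le (hN i)).mp ?_
      rw [← norm_pow, hy, norm_inv, hτ, hρN]
    refine ⟨fun i => (nthRoots (N i) τ⁻¹).toFinset.image (Z i), fun i => ?_, fun i z hz => ?_, ?_⟩
    · rw [Finset.card_image_of_injOn, card_nthRoots_toFinset (hN i) (inv_ne_zero hτ0)]
      exact (hinj i).mono fun y hy => (hmem i y hy).1
    · obtain ⟨y, hy, rfl⟩ := Finset.mem_image.mp hz
      exact ⟨y, (hmem i y hy).1, rfl⟩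
    · have hnd := secularPoly_natDegree A u v τ hdeg
      refine roots_eq_biUnion (fun h => ?_) ?_ ?_ ?_
      · rw [h, natDegree_zero] at hnd
        omega
      · intro i z hz
        obtain ⟨y, hy, rfl⟩ := Finset.mem_image.mp hz
        obtain ⟨h1, h2⟩ := hmem i y hy
        rwa [isRoot_secularPoly_iff A u v τ _ (hZA i y h1), hZQ i y h1]
      · intro i j hij
        rw [Finset.disjoint_left]
        intro z hz hz'
        obtain ⟨y, hy, rfl⟩ := Finset.mem_image.mp hz
        obtain ⟨y', hy', he⟩ := Finset.mem_image.mp hz'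
        exact Set.disjoint_left.mp (hdisj hij) ⟨y, (hmem i y hy).1, rfl⟩
          ⟨y', (hmem j y' hy').1, he⟩
      · rw [hnd, ← hsum]
        refine Finset.sum_congr rfl fun i _ => ?_
        rw [Finset.card_image_of_injOn, card_nthRoots_toFinset (hN i) (inv_ne_zero hτ0)]
        exact (hinj i).mono fun y hy => (hmem i y hy).1
  have hnz : ∀ τ, secularPoly A u v τ ≠ 0 := fun τ h => by
    have hnd := secularPoly_natDegree A u v τ hdeg
    rw [h, natDegree_zero] at hnd
    omega
  refine ⟨?_, ?_, hspec⟩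
  · ext z
    simp only [Set.mem_iUnion, sigmaSet, Set.mem_sdiff]
    constructor
    · rintro ⟨i, y, hy, rfl⟩
      refine ⟨?_, hZA i y hy⟩
      have hyn : ‖y‖ = ρ i := mem_sphere_zero_iff_norm.mp hy
      have hy0 : y ≠ 0 := norm_ne_zero_iff.mp (hyn ▸ (hρ i).ne')
      have hn : ‖(y ^ N i)⁻¹‖ = t := by rw [norm_inv, norm_pow, hyn, hρN, inv_inv]
      have hm : (y ^ N i)⁻¹ ∈ Metric.sphere (0 : ℂ) |t| := by
        rw [mem_sphere_zero_iff_norm, hn, abs_of_pos ht]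
      rw [← image_circleMap_Ioc] at hm
      obtain ⟨θ, hθ, he⟩ := hm
      refine ⟨θ, Set.Ioc_subset_Icc_self hθ, ?_⟩
      refine hspec i y hy _ ?_
      rw [circleMap_zero] at he
      rw [he, inv_mul_cancel₀ (pow_ne_zero _ hy0)]
    · rintro ⟨⟨θ, -, hz⟩, hzA⟩
      have hτ : ‖(t : ℂ) * Complex.exp ((θ : ℂ) * Complex.I)‖ = t := by
        rw [norm_mul, Complex.norm_exp_ofReal_mul_I, mul_one, Complex.norm_real,
          Real.norm_of_nonneg ht.le]
      rw [mem_spectrum_rankOnePert_iff A u v _ z hzA,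
        ← isRoot_secularPoly_iff A u v _ z hzA] at hz
      obtain ⟨E, -, hE, hr⟩ := hall _ hτ
      have := (mem_roots (hnz _)).mpr hz
      rw [hr, Finset.mem_val, Finset.mem_biUnion] at this
      obtain ⟨i, -, hi⟩ := this
      exact ⟨i, hE i z hi⟩
  · intro τ hτ i
    obtain ⟨E, hc, hE, hr⟩ := hall τ hτ
    rw [eigCount_rankOnePert A u v τ (hnz τ), hr, ← Finset.filter_val, Finset.card_val, ← hc i]
    · congr 1
      ext z
      rw [Finset.mem_filter, Finset.mem_biUnion]
      constructor
      · rintro ⟨⟨j, -, hj⟩, hz⟩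
        by_contra hzi
        have hij : i ≠ j := by rintro rfl; exact hzi hj
        exact Set.disjoint_left.mp (hdisj hij) hz (hE j z hj)
      · exact fun hz => ⟨⟨i, Finset.mem_univ i, hz⟩, hE i z hz⟩
    · rintro z ⟨y, hy, rfl⟩
      exact hZA i y hy

/-- On a small punctured disc, the branches are injective with disjoint images and share every
property that holds near `0`. -/
theorem exists_radius {ι : Type*} [Finite ι] {Z : ι → ℂ → ℂ} {L : ι → Filter ℂ}
    (hinj : ∀ i, ∃ s ∈ nhdsWithin (0 : ℂ) {0}ᶜ, Set.InjOn (Z i) s)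
    (hlim : ∀ i, Filter.Tendsto (Z i) (nhdsWithin (0 : ℂ) {0}ᶜ) (L i))
    (hL : Pairwise fun i j => Disjoint (L i) (L j))
    {P : ι → ℂ → Prop} (hP : ∀ i, ∀ᶠ y in nhdsWithin (0 : ℂ) {0}ᶜ, P i y) :
    ∃ r > 0, ∀ ρ : ι → ℝ, (∀ i, 0 < ρ i) → (∀ i, ρ i < r) →
      (∀ i, Set.InjOn (Z i) (Metric.sphere 0 (ρ i))) ∧
      (Pairwise fun i j =>
        Disjoint (Z i '' Metric.sphere 0 (ρ i)) (Z j '' Metric.sphere 0 (ρ j))) ∧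
      ∀ i, ∀ y ∈ Metric.sphere 0 (ρ i), P i y := by
  choose s hs hsinj using hinj
  obtain ⟨U, hU, hUd⟩ := hL.exists_mem_filter_of_disjoint
  have hev : ∀ᶠ y in nhdsWithin (0 : ℂ) {0}ᶜ, ∀ i, y ∈ s i ∧ Z i y ∈ U i ∧ P i y :=
    Filter.eventually_all.mpr fun i =>
      Filter.Eventually.and (hs i) (((hlim i).eventually (hU i)).and (hP i))
  obtain ⟨r, hr, h⟩ := Metric.eventually_nhds_iff.mp (eventually_nhdsWithin_iff.mp hev)
  refine ⟨r, hr, fun ρ h0 hρ => ?_⟩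
  have key : ∀ i, ∀ y ∈ Metric.sphere (0 : ℂ) (ρ i), y ∈ s i ∧ Z i y ∈ U i ∧ P i y := by
    intro i y hy
    rw [mem_sphere_zero_iff_norm] at hy
    exact h (by rw [dist_zero_right, hy]; exact hρ i)
      (norm_ne_zero_iff.mp (hy ▸ (h0 i).ne')) i
  refine ⟨fun i => (hsinj i).mono fun y hy => (key i y hy).1, fun i j hij => ?_,
    fun i y hy => (key i y hy).2.2⟩
  simp only
  rw [Set.disjoint_left]
  rintro _ ⟨y, hy, rfl⟩ ⟨y', hy', he⟩
  exact Set.disjoint_left.mp (hUd hij) (key i y hy).2.1 (he ▸ (key j y' hy').2.1)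

/-- The circle is traced once in either direction, according to the sign `ε`. -/
theorem image_circleMap_sign_mul {ρ : ℝ} (hρ : 0 < ρ) {ε : ℝ} (hε : ε = 1 ∨ ε = -1) :
    (fun θ => circleMap 0 ρ (ε * θ)) '' Set.Icc 0 (2 * Real.pi) = Metric.sphere 0 ρ := by
  have h1 : circleMap 0 ρ '' Set.Icc 0 (2 * Real.pi) = Metric.sphere 0 ρ := by
    refine Set.Subset.antisymm ?_ ?_
    · rintro _ ⟨θ, -, rfl⟩
      exact circleMap_mem_sphere _ hρ.le _
    · nth_rewrite 1 [← abs_of_pos hρ]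
      rw [← image_circleMap_Ioc]
      exact Set.image_mono Set.Ioc_subset_Icc_self
  rcases hε with rfl | rfl
  · simpa using h1
  · rw [← h1]
    have hp : ∀ θ, circleMap 0 ρ (2 * Real.pi - θ) = circleMap 0 ρ (-1 * θ) := fun θ => by
      have := periodic_circleMap 0 ρ (-1 * θ)
      rw [← this]
      congr 1
      ring
    ext z
    constructor
    · rintro ⟨θ, hθ, rfl⟩
      exact ⟨2 * Real.pi - θ, ⟨by linarith [hθ.2], by linarith [hθ.1]⟩, hp θ⟩
    · rintro ⟨θ, hθ, rfl⟩
      refine ⟨2 * Real.pi - θ, ⟨by linarith [hθ.2], by linarith [hθ.1]⟩, ?_⟩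
      simp only
      rw [← hp, sub_sub_cancel]

theorem injOn_circleMap_sign_mul {ρ : ℝ} (hρ : 0 < ρ) {ε : ℝ} (hε : ε = 1 ∨ ε = -1) :
    Set.InjOn (fun θ => circleMap 0 ρ (ε * θ)) (Set.Ico 0 (2 * Real.pi)) := by
  intro θ hθ θ' hθ' h
  have hd : |ε * θ - ε * θ'| < 2 * Real.pi := by
    rw [← mul_sub, abs_mul, show |ε| = 1 by rcases hε with rfl | rfl <;> simp, one_mul, abs_lt]
    constructor <;> linarith [hθ.1, hθ.2, hθ'.1, hθ'.2]
  have := eq_of_circleMap_eq hρ.ne' hd h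
  rcases hε with rfl | rfl <;> linarith

theorem rpow_neg_one_div_pow {t : ℝ} (ht : 0 < t) (N e : ℕ) :
    (t ^ (-(1 / (N : ℝ)))) ^ e = t ^ (-((e : ℝ) / N)) := by
  rw [← Real.rpow_natCast, ← Real.rpow_mul ht.le]
  congr 1
  ring

/-- Branches whose exponents add up to `deg m_A` give, for large `t`, simple closed curves which make
up `σ(A,u,v;t)`: the `i`-th is the image of the circle of radius `t ^ (-1 / N i)`, and `ε i` is the
direction in which it is run through. An expansion of `Z i` at `0` up to `O(y ^ e i)` becomes an
expansion of the curve, uniform in `θ`. -/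
theorem exists_curves_of_branches {n : ℕ} (A : Matrix (Fin n) (Fin n) ℂ) (u v : Fin n → ℂ)
    {ι : Type*} [Fintype ι] {N : ι → ℕ} (hN : ∀ i, N i ≠ 0)
    (hdeg : (pUV A u v).natDegree < (minpoly ℂ A).natDegree)
    (hsum : ∑ i, N i = (minpoly ℂ A).natDegree)
    {Z : ι → ℂ → ℂ} {L : ι → Filter ℂ} (hZ : ∀ i, IsBranch A u v (N i) (Z i) (L i))
    (hL : Pairwise fun i j => Disjoint (L i) (L j))
    {a : ι → ℂ → ℂ} {e : ι → ℕ}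
    (ha : ∀ i, (fun y => Z i y - a i y) =O[nhdsWithin 0 {0}ᶜ] fun y => y ^ e i)
    {ε : ι → ℝ} (hε : ∀ i, ε i = 1 ∨ ε i = -1) :
    ∃ (T : ℝ) (Γ : ι → ℝ → ℝ → ℂ) (K : ι → ℝ), 0 < T ∧ ∀ t : ℝ, T ≤ t →
      (∀ i, ContinuousOn (Γ i t) (Set.Icc 0 (2 * Real.pi)) ∧
        Γ i t 0 = Γ i t (2 * Real.pi) ∧ Set.InjOn (Γ i t) (Set.Ico 0 (2 * Real.pi))) ∧
      (∀ i j, i ≠ j → Disjoint (Γ i t '' Set.Icc 0 (2 * Real.pi))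
        (Γ j t '' Set.Icc 0 (2 * Real.pi))) ∧
      (⋃ i, Γ i t '' Set.Icc 0 (2 * Real.pi)) = sigmaSet A u v t ∧
      (∀ i, ∀ τ : ℂ, ‖τ‖ = t →
        eigCount (rankOnePert A u v τ) (Γ i t '' Set.Icc 0 (2 * Real.pi)) = N i) ∧
      (∀ i (θ : ℝ), Γ i t θ ∈ spectrum ℂ (rankOnePert A u v
        ((t : ℂ) * Complex.exp (-((N i : ℂ) * (ε i * θ) * Complex.I))))) ∧
      (∀ i (θ : ℝ), ‖Γ i t θ - a i (((t ^ (-(1 / (N i : ℝ))) : ℝ) : ℂ) *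
        Complex.exp (ε i * θ * Complex.I))‖ ≤ K i * t ^ (-((e i : ℝ) / N i))) := by
  choose K hK using fun i => (ha i).bound
  obtain ⟨r, hr, hrad⟩ := exists_radius (fun i => (hZ i).injOn) (fun i => (hZ i).tendsto) hL
    (fun i => (hK i).and ((hZ i).continuousAt.and ((hZ i).notMem.and (hZ i).starForm_eq)))
  have hsmall : ∀ᶠ t : ℝ in Filter.atTop, 0 < t ∧ ∀ i, t ^ (-(1 / (N i : ℝ))) < r := by
    refine (Filter.eventually_gt_atTop 0).and (Filter.eventually_all.mpr fun i => ?_)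
    have hpos : 0 < 1 / (N i : ℝ) :=
      one_div_pos.mpr (Nat.cast_pos.mpr (Nat.pos_of_ne_zero (hN i)))
    exact (tendsto_rpow_neg_atTop hpos).eventually (gt_mem_nhds hr)
  obtain ⟨T, hT⟩ := Filter.eventually_atTop.mp hsmall
  refine ⟨T, fun i t θ => Z i (circleMap 0 (t ^ (-(1 / (N i : ℝ)))) (ε i * θ)), K,
    (hT T le_rfl).1, fun t ht => ?_⟩
  obtain ⟨ht0, htr⟩ := hT t ht
  have hρ : ∀ i, 0 < t ^ (-(1 / (N i : ℝ))) := fun i => Real.rpow_pos_of_pos ht0 _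
  obtain ⟨hinj, hdisj, hP⟩ := hrad _ hρ htr
  have himg : ∀ i, (fun θ => Z i (circleMap 0 (t ^ (-(1 / (N i : ℝ)))) (ε i * θ))) ''
      Set.Icc 0 (2 * Real.pi) = Z i '' Metric.sphere 0 (t ^ (-(1 / (N i : ℝ)))) := fun i => by
    rw [← image_circleMap_sign_mul (hρ i) (hε i), Set.image_image]
  have hρN : ∀ i, (t ^ (-(1 / (N i : ℝ)))) ^ N i = t⁻¹ := fun i => by
    rw [rpow_neg_one_div_pow ht0, div_self (Nat.cast_ne_zero.mpr (hN i)), Real.rpow_neg_one]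
  have hsph : ∀ i θ, circleMap 0 (t ^ (-(1 / (N i : ℝ)))) (ε i * θ) ∈
      Metric.sphere (0 : ℂ) (t ^ (-(1 / (N i : ℝ)))) :=
    fun i θ => circleMap_mem_sphere _ (hρ i).le _
  obtain ⟨hunion, hcount, hspec⟩ := spheres_of_branches A u v hN hdeg hsum ht0 hρ hρN hinj
    (fun i y hy => (hP i y hy).2.2.1) (fun i y hy => (hP i y hy).2.2.2) hdisj
  refine ⟨fun i => ⟨?_, ?_, ?_⟩, ?_, ?_, ?_, ?_, ?_⟩
  · intro θ _
    refine ContinuousAt.continuousWithinAt ?_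
    refine ContinuousAt.comp (f := fun θ => circleMap 0 (t ^ (-(1 / (N i : ℝ)))) (ε i * θ))
      (hP i _ (hsph i θ)).2.1 ?_
    exact ((continuous_circleMap 0 _).comp (continuous_const.mul continuous_id)).continuousAt
  · have hp := periodic_circleMap 0 (t ^ (-(1 / (N i : ℝ))))
    refine congrArg (Z i) ?_
    rcases hε i with h | h
    · rw [h, mul_zero, one_mul, ← hp 0, zero_add]
    · rw [h, mul_zero, ← hp (-1 * (2 * Real.pi))]
      congr 1
      ring
  · intro θ hθ θ' hθ' h
    exact injOn_circleMap_sign_mul (hρ i) (hε i) hθ hθ' (hinj i (hsph i θ) (hsph i θ') h)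
  · intro i j hij
    rw [himg, himg]
    exact hdisj hij
  · rw [← hunion]
    exact Set.iUnion_congr himg
  · intro i τ hτ
    rw [himg]
    exact hcount τ hτ i
  · intro i θ
    refine hspec i _ (hsph i θ) _ ?_
    rw [circleMap_zero, mul_pow, ← Complex.exp_nat_mul, ← Complex.ofReal_pow, hρN,
      mul_mul_mul_comm, ← Complex.exp_add, Complex.ofReal_inv,
      mul_inv_cancel₀ (Complex.ofReal_ne_zero.mpr ht0.ne'), one_mul, ← Complex.exp_zero]
    congr 1
    push_cast
    ring
  · intro i θ
    have h := (hP i _ (hsph i θ)).1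
    rw [norm_pow, mem_sphere_zero_iff_norm.mp (hsph i θ), rpow_neg_one_div_pow ht0] at h
    have he : circleMap 0 (t ^ (-(1 / (N i : ℝ)))) (ε i * θ) =
        ((t ^ (-(1 / (N i : ℝ))) : ℝ) : ℂ) * Complex.exp (ε i * θ * Complex.I) := by
      rw [circleMap_zero, Complex.ofReal_mul]
    rw [← he]
    exact h

/-! ### The asymptotics of the curves -/

theorem corollary2 (n : ℕ) (A : Matrix (Fin n) (Fin n) ℂ) (u v : Fin n → ℂ)
    (κ : ℕ) (hκ : κ < (minpoly ℂ A).natDegree)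
    (hzero : ∀ i < κ, starForm (A ^ i) u v = 0)
    (hne : starForm (A ^ κ) u v ≠ 0)
    -- `ζ 0, …, ζ (ν - 1)` are the distinct roots of `p_{uv}`, with multiplicities `k j`
    (ν : ℕ) (ζ : Fin ν → ℂ) (hζinj : Function.Injective ζ)
    (hζ : ∀ z : ℂ, (pUV A u v).IsRoot z ↔ ∃ j, ζ j = z)
    (k : Fin ν → ℕ) (hk : ∀ j, k j = (pUV A u v).rootMultiplicity (ζ j))
    (hdisj : ∀ j, ¬ (minpoly ℂ A).IsRoot (ζ j))
    -- the coefficients of the expansions, for any choice of the complex roots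
    (cm c₀ c₁ : ℂ)
    (hcm : cm ^ (κ + 1) = starForm (A ^ κ) u v)
    (hc₀ : c₀ = 1 / ((κ : ℂ) + 1) * (starForm (A ^ (κ + 1)) u v / starForm (A ^ κ) u v))
    (hc₁ : c₁ = 1 / ((κ : ℂ) + 1) * (1 / (starForm (A ^ κ) u v * cm)) *
      (starForm (A ^ (κ + 2)) u v - ((κ : ℂ) + 2) / (2 * ((κ : ℂ) + 1)) *
        (starForm (A ^ (κ + 1)) u v ^ 2 / starForm (A ^ κ) u v)))
    (b₁ b₂ : Fin ν → ℂ)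
    (hb₁ : ∀ j, b₁ j ^ k j = (aCoeff A u v (k j + 1) (ζ j))⁻¹)
    (hb₂ : ∀ j, b₂ j = -(1 / (k j : ℂ)) *
      (b₁ j ^ 2 * aCoeff A u v (k j + 2) (ζ j) / aCoeff A u v (k j + 1) (ζ j))) :
    (∀ j, aCoeff A u v (k j + 1) (ζ j) ≠ 0) ∧
    -- `Γ j t θ`; the last index is the curve of the eigenvalues going to infinity
    ∃ (T : ℝ) (Γ : Fin (ν + 1) → ℝ → ℝ → ℂ), 0 < T ∧
      (∀ t : ℝ, T ≤ t →
        -- simple closed curves, pairwise disjoint, which together make up the set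
        (∀ j, ContinuousOn (Γ j t) (Set.Icc 0 (2 * Real.pi)) ∧
          Γ j t 0 = Γ j t (2 * Real.pi) ∧
          Set.InjOn (Γ j t) (Set.Ico 0 (2 * Real.pi))) ∧
        (∀ i j, i ≠ j → Disjoint (Γ i t '' Set.Icc 0 (2 * Real.pi))
          (Γ j t '' Set.Icc 0 (2 * Real.pi))) ∧
        (⋃ j, Γ j t '' Set.Icc 0 (2 * Real.pi)) = sigmaSet A u v t ∧
        -- `κ + 1` eigenvalues of each `B(τ)`, `|τ| = t`, lie on the last curve and trace it out
        (∀ τ : ℂ, ‖τ‖ = t →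
          eigCount (rankOnePert A u v τ) (Γ (Fin.last ν) t '' Set.Icc 0 (2 * Real.pi)) = κ + 1) ∧
        (∀ θ ∈ Set.Icc (0 : ℝ) (2 * Real.pi), Γ (Fin.last ν) t θ ∈ spectrum ℂ
          (rankOnePert A u v ((t : ℂ) * Complex.exp (((κ : ℂ) + 1) * θ * Complex.I)))) ∧
        -- `k j` eigenvalues of each `B(τ)`, `|τ| = t`, lie on the `j`-th curve and trace it out
        (∀ j : Fin ν, ∀ τ : ℂ, ‖τ‖ = t →
          eigCount (rankOnePert A u v τ) (Γ j.castSucc t '' Set.Icc 0 (2 * Real.pi)) = k j) ∧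
        (∀ j : Fin ν, ∀ θ ∈ Set.Icc (0 : ℝ) (2 * Real.pi), Γ j.castSucc t θ ∈ spectrum ℂ
          (rankOnePert A u v ((t : ℂ) * Complex.exp (-((k j : ℂ) * θ * Complex.I)))))) ∧
      (∃ K : ℝ, ∀ t : ℝ, T ≤ t → ∀ θ ∈ Set.Icc (0 : ℝ) (2 * Real.pi),
        ‖Γ (Fin.last ν) t θ -
          (cm * ((t ^ (1 / ((κ : ℝ) + 1)) : ℝ) : ℂ) * Complex.exp (θ * Complex.I) + c₀ +
            c₁ * ((t ^ (-(1 / ((κ : ℝ) + 1))) : ℝ) : ℂ) * Complex.exp (-(θ * Complex.I)))‖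
          ≤ K * t ^ (-(2 / ((κ : ℝ) + 1)))) ∧
      (∀ j : Fin ν, ∃ K : ℝ, ∀ t : ℝ, T ≤ t → ∀ θ ∈ Set.Icc (0 : ℝ) (2 * Real.pi),
        ‖Γ j.castSucc t θ -
          (ζ j - b₁ j * ((t ^ (-(1 / (k j : ℝ))) : ℝ) : ℂ) * Complex.exp (θ * Complex.I) -
            b₂ j * ((t ^ (-(2 / (k j : ℝ))) : ℝ) : ℂ) * Complex.exp (2 * θ * Complex.I))‖
          ≤ K * t ^ (-(3 / (k j : ℝ)))) := by
  have hp : pUV A u v ≠ 0 := pUV_ne_zero A u v hκ hzero hne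
  have hmA : ∀ j, ζ j ∉ spectrum ℂ A := fun j h =>
    hdisj j ((mem_spectrum_iff_isRoot_minpoly A _).mp h)
  have hk0 : ∀ j, k j ≠ 0 := fun j => by
    rw [hk, ← Nat.pos_iff_ne_zero, rootMultiplicity_pos hp]
    exact (hζ _).mpr ⟨j, rfl⟩
  have hksum : ∑ j, k j = (pUV A u v).natDegree := by
    simp only [hk]
    exact sum_rootMultiplicity hp hζinj hζ
  refine ⟨fun j => (aCoeff_at_root hp (hk j) (hmA j)).2, ?_⟩
  choose Zf hZf hZfO using fun j =>
    exists_branch_at_root hp (hk j) (hk0 j) (hmA j) (hb₁ j) (hb₂ j)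
  obtain ⟨Zi, hZi, hZiO⟩ := exists_branch_at_infinity hzero hne hcm hc₀ hc₁
  -- the curve at infinity is run through backwards in `y`, because `Z y ~ cm / y` there
  obtain ⟨T, Γ, K, hT, hΓ⟩ := exists_curves_of_branches A u v
    (N := Fin.snoc (α := fun _ => ℕ) k (κ + 1))
    (Z := Fin.snoc (α := fun _ => ℂ → ℂ) Zf Zi)
    (L := Fin.snoc (α := fun _ => Filter ℂ) (fun j => nhds (ζ j)) (Bornology.cobounded ℂ))
    (a := Fin.snoc (α := fun _ => ℂ → ℂ) (fun j y => ζ j - b₁ j * y - b₂ j * y ^ 2)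
      (fun y => cm * y⁻¹ + c₀ + c₁ * y))
    (e := Fin.snoc (α := fun _ => ℕ) (fun _ => 3) 2)
    (ε := Fin.snoc (α := fun _ => ℝ) (fun _ => 1) (-1))
    (by simpa [Fin.forall_fin_succ'] using hk0) (natDegree_pUV_lt A u v hκ hzero hne)
    (by simp [Fin.sum_univ_castSucc, hksum, natDegree_pUV A u v hκ hzero hne])
    (by simpa [Fin.forall_fin_succ'] using ⟨hZf, hZi⟩)
    (by
      intro i j hij
      induction i using Fin.lastCases with
      | last =>
        induction j using Fin.lastCases with
        | last => exact absurd rfl hij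
        | cast j => simpa using Metric.disjoint_cobounded_nhds (ζ j)
      | cast i =>
        induction j using Fin.lastCases with
        | last => simpa using Metric.disjoint_nhds_cobounded (ζ i)
        | cast j =>
          have hne' : ζ i ≠ ζ j := hζinj.ne fun h => hij (congrArg Fin.castSucc h)
          simpa using hne')
    (by simpa [Fin.forall_fin_succ'] using ⟨hZfO, hZiO⟩)
    (by simp [Fin.forall_fin_succ'])
  refine ⟨T, Γ, hT, fun t ht => ?_, ⟨K (Fin.last ν), fun t ht θ _ => ?_⟩,
    fun j => ⟨K j.castSucc, fun t ht θ _ => ?_⟩⟩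
  · obtain ⟨h1, h2, h3, h4, h5, -⟩ := hΓ t ht
    refine ⟨h1, h2, h3, ?_, fun θ _ => ?_, fun j => ?_, fun j θ _ => ?_⟩
    · simpa using h4 (Fin.last ν)
    · have := h5 (Fin.last ν) θ
      simp only [Fin.snoc_last] at this
      have he : -(((κ + 1 : ℕ) : ℂ) * (((-1 : ℝ) : ℂ) * θ) * Complex.I) =
          ((κ : ℂ) + 1) * θ * Complex.I := by
        push_cast
        ring
      rwa [he] at this
    · simpa using h4 j.castSucc
    · simpa using h5 j.castSucc θ
  · have ht0 : 0 < t := hT.trans_le ht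
    have h6 := (hΓ t ht).2.2.2.2.2 (Fin.last ν) θ
    simp only [Fin.snoc_last] at h6
    push_cast at h6
    convert h6 using 3
    rw [mul_inv, ← Complex.ofReal_inv, ← Real.rpow_neg ht0.le, neg_neg, ← Complex.exp_neg,
      neg_one_mul, neg_mul, neg_neg, mul_assoc, mul_assoc]
  · have ht0 : 0 < t := hT.trans_le ht
    have h6 := (hΓ t ht).2.2.2.2.2 j.castSucc θ
    simp only [Fin.snoc_castSucc] at h6
    push_cast at h6
    convert h6 using 3
    rw [mul_pow, ← Complex.ofReal_pow, rpow_neg_one_div_pow ht0, ← Complex.exp_nat_mul, one_mul,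
      mul_assoc, mul_assoc, mul_assoc]
    push_cast
    rfl
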